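/- Throughout, a random countable set $\Pi$ in a measurable space $E$ is a Poisson process with ($\sigma$-finite, nonatomic) mean measure $\nu$ if for every measurable $B\subseteq E$ the count $N(B)=\#(\Pi\cap B)\in\{0,1,\dots\}\cup\{\infty\}$ is a random variable with law $\mathrm{Poisson}(\nu(B))$ (the point mass at $\infty$ when $\nu(B)=\infty$), and for all disjoint measurable $A_1,\dots,A_m$ the counts $N(A_1),\dots,N(A_m)$ are independent. For a finite nonzero Borel measure $P$ on $\mathbb{R}^n$, an exponential race with measure $P$ is a random countable set $R\subseteq\mathbb{R}^+\times\mathbb{R}^n$ that is a Poisson process with mean measure $\lambda\times P$, where $\lambda$ is Lebesgue measure on $\mathbb{R}^+=(0,\infty)$, and that is almost surely totally ordered by its first coordinate (distinct points have distinct times). \textbf{Lemma (Accept-Reject).} Let $P$ and $Q$ be finite nonzero Borel measures on $\mathbb{R}^n$ with measurable densities $f,g:\mathbb{R}^n\to[0,\infty)$ with respect to a common measure $\mu$, that is $P(B)=\int_B f\,d\mu$ and $Q(B)=\int_B g\,d\mu$ for all Borel sets $B$. Suppose that $\{x: f(x)\neq 0\}=\{x: g(x)\neq 0\}$ and that $M\ge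 0$ is a constant with $f(x)/g(x)\le M$ for all $x$ with $g(x)\neq 0$. Let $R$ be an exponential race with measure $MQ(\cdot)$, and let $\mathrm{accept}(t,x)\in\{0,1\}$ be random marks which, at the points of $R$, are independent Bernoulli variables with success probabilities $$\rho(t,x)=\frac{f(x)}{g(x)M}$$ given $R$. This means: the points of $R$ can almost surely be listed without repetition as $Y_0,Y_1,\dots$ by random variables $Y_i$, such that, conditionally on the list, the events $\{\mathrm{accept}(Y_i)=1\}$ are independent with probabilities $\rho(Y_i)$. Then $$\mathrm{thin}(R,\mathrm{accept})=\{(t,x)\in R:\ \mathrm{accept}(t,x)=1\}$$ is an exponential race with measure $P$. -/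

import Mathlib

open MeasureTheory ProbabilityTheory Set
open scoped NNReal ENNReal

noncomputable section

/-- The Poisson distribution with rate `r ∈ [0, ∞]`, as a law on `{0, 1, 2, …} ∪ {∞}`.
For rate `∞` it is the point mass at `∞`. -/
def poissonLaw (r : ℝ≥0∞) : Measure ℕ∞ :=
  if r = ∞ then Measure.dirac ⊤
  else (poissonMeasure r.toNNReal).map (fun k : ℕ => (k : ℕ∞))

/-- The number of points `N(B) = #(Π ∩ B)` of the random set `Π` that lie in `B`. -/
def pointCount {Ω E : Type*} (R : Ω → Set E) (B : Set E) (ω : Ω) : ℕ∞ :=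
  (R ω ∩ B).encard

/-- The random countable set `R` is a Poisson process with (σ-finite, nonatomic) mean measure `μ`
on the probability space `(Ω, Pr)`. -/
structure IsPoissonProcess {Ω E : Type*} [MeasurableSpace Ω] [MeasurableSpace E]
    (Pr : Measure Ω) (R : Ω → Set E) (μ : Measure E) : Prop where
  sigmaFinite : SigmaFinite μ
  nonatomic : ∀ x, μ {x} = 0
  countable : ∀ ω, (R ω).Countable
  /-- `N(B)` is a random variable with law `Poisson(μ(B))`. -/
  law_count : ∀ B : Set E, MeasurableSet B → HasLaw (pointCount R B) (poissonLaw (μ B)) Pr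
  /-- The counts of finitely many disjoint sets are independent. -/
  indep_count : ∀ (m : ℕ) (A : Fin m → Set E), (∀ j, MeasurableSet (A j)) →
    Pairwise (fun i j => Disjoint (A i) (A j)) → iIndepFun (fun j => pointCount R (A j)) Pr

/-- The measure `λ × P` on `ℝ × F`, where `λ` is Lebesgue measure on the positive reals. -/
def raceMeasure {F : Type*} [MeasurableSpace F] (P : Measure F) : Measure (ℝ × F) :=
  (volume.restrict (Ioi (0 : ℝ))).prod P

/-- The random countable set `R ⊆ ℝ⁺ × F` is an exponential race with the finite nonzero
measure `P`. -/
structure IsExponentialRace {Ω F : Type*} [MeasurableSpace Ω] [MeasurableSpace F]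
    (Pr : Measure Ω) (R : Ω → Set (ℝ × F)) (P : Measure F) : Prop where
  finite : IsFiniteMeasure P
  nonzero : P ≠ 0
  subset : ∀ ω, R ω ⊆ Ioi (0 : ℝ) ×ˢ (univ : Set F)
  poisson : IsPoissonProcess Pr R (raceMeasure P)
  /-- Almost surely the points are totally ordered by time: distinct points arrive at
  distinct times. -/
  ordered : ∀ᵐ ω ∂Pr, InjOn Prod.fst (R ω)

/-- `thin(R, S)`: the points `X` of `R` with `S(X) = 1`. -/
def thin {Ω E : Type*} (R : Ω → Set E) (S : E → Ω → Bool) (ω : Ω) : Set E :=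
  {x | x ∈ R ω ∧ S x ω = true}

/-- The marks `S(x)`, read at the points `x` of the random countable set `R`, are independent
`Bernoulli(ρ(x))` variables given `R`.

The points of `R` are listed, measurably and without repetition, as `Y 0, Y 1, …` (`κ ≤ ∞` of
them), and conditionally on the list the events `S(Y i) = 1` are independent with probabilities
`ρ(Y i)`. Marks away from the points of `R` play no role. (Asking instead only that the uncountable
family `S(x)`, `x ∈ E`, be independent and independent of `R` would not determine the joint law of
the marks at the random points of `R`.) -/
def IsBernoulliMarking {Ω E : Type*} [MeasurableSpace Ω] [MeasurableSpace E]
    (Pr : Measure Ω) (R : Ω → Set E) (S : E → Ω → Bool) (ρ : E → ℝ≥0) : Prop :=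
  ∃ (κ : Ω → ℕ∞) (Y : ℕ → Ω → E),
    Measurable κ ∧ (∀ i, Measurable (Y i)) ∧
    (∀ᵐ ω ∂Pr, R ω = {x | ∃ i : ℕ, (i : ℕ∞) < κ ω ∧ Y i ω = x} ∧
      InjOn (fun i : ℕ => Y i ω) {i | (i : ℕ∞) < κ ω}) ∧
    (∀ i : ℕ, MeasurableSet {ω | (i : ℕ∞) < κ ω ∧ S (Y i ω) ω = true}) ∧
    (∀ I : Finset ℕ,
      Pr⟦⋂ i ∈ I, {ω | (i : ℕ∞) < κ ω ∧ S (Y i ω) ω = true} |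
          MeasurableSpace.comap (fun ω => (κ ω, fun i => Y i ω)) inferInstance⟧
        =ᵐ[Pr] fun ω => ∏ i ∈ I, if (i : ℕ∞) < κ ω then (ρ (Y i ω) : ℝ) else 0)

end

/-! A Poisson process with mean measure `ν` is characterised by its Laplace functional: `E exp(-∑
φ(x)) = exp(-∫ (1 - e^{-φ}) dν)`, the sum running over its points
(`IsPoissonProcess.integral_expNeg_pointSum` and its converse
`isPoissonProcess_of_integral_expNeg_pointSum`).

Given the points, keeping `x` with probability `ρ x` turns the factor `e^{-ψ(x)}` into its mean `1 -
ρ(x)(1 - e^{-ψ(x)})`. Call this `e^{-φ(x)}`: the functional of the thinned set at `ψ` is that of the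
original at `φ`. Since `1 - e^{-φ} = ρ(1 - e^{-ψ})`, the thinned set is Poisson with mean `ρ dν`
(`IsPoissonProcess.thin`).

For the race, `M g ρ = f`, so `ρ` turns `λ × MQ` into `λ × P`; distinctness of times passes to
subsets. -/

/-! ### The exponential on `[0, ∞]` -/

/-- The function `x ↦ exp (-x)` on `[0, ∞]`, with value `0` at `∞`. -/
noncomputable def expNeg (x : ℝ≥0∞) : ℝ := if x = ∞ then 0 else Real.exp (-x.toReal)

@[simp] lemma expNeg_top : expNeg ∞ = 0 := if_pos rfl

lemma expNeg_of_ne_top {x : ℝ≥0∞} (hx : x ≠ ∞) : expNeg x = Real.exp (-x.toReal) := if_neg hx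

@[simp] lemma expNeg_zero : expNeg 0 = 1 := by simp [expNeg]

lemma expNeg_nonneg (x : ℝ≥0∞) : 0 ≤ expNeg x := by
  unfold expNeg; split_ifs <;> positivity

lemma expNeg_le_one (x : ℝ≥0∞) : expNeg x ≤ 1 := by
  unfold expNeg; split_ifs <;> simp

lemma norm_expNeg_le_one (x : ℝ≥0∞) : ‖expNeg x‖ ≤ 1 := by
  rw [Real.norm_of_nonneg (expNeg_nonneg x)]; exact expNeg_le_one x

lemma expNeg_eq_toReal_exp (x : ℝ≥0∞) : expNeg x = (EReal.exp (-(x : EReal))).toReal := by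
  induction x using ENNReal.recTopCoe with
  | top => simp
  | coe x =>
    rw [expNeg_of_ne_top ENNReal.coe_ne_top,
      show (((x : ℝ≥0) : ℝ≥0∞) : EReal) = ((x : ℝ) : EReal) from rfl, ← EReal.coe_neg, EReal.exp_coe,
      ENNReal.toReal_ofReal (Real.exp_pos _).le]
    rfl

lemma continuous_expNeg : Continuous expNeg := by
  have h : expNeg = fun x : ℝ≥0∞ => (EReal.exp (-(x : EReal))).toReal :=
    funext expNeg_eq_toReal_exp
  rw [h]
  refine ENNReal.continuousOn_toReal.comp_continuous
    (ENNReal.continuous_exp.comp (continuous_neg.comp continuous_coe_ennreal_ereal)) fun x => ?_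
  simp

@[fun_prop] lemma measurable_expNeg : Measurable expNeg := continuous_expNeg.measurable

lemma expNeg_add (x y : ℝ≥0∞) : expNeg (x + y) = expNeg x * expNeg y := by
  by_cases hx : x = ∞
  · simp [hx]
  by_cases hy : y = ∞
  · simp [hy]
  rw [expNeg_of_ne_top hx, expNeg_of_ne_top hy, expNeg_of_ne_top (by simp [hx, hy]),
    ENNReal.toReal_add hx hy, neg_add, Real.exp_add]

lemma expNeg_sum {ι : Type*} (s : Finset ι) (x : ι → ℝ≥0∞) :
    expNeg (∑ i ∈ s, x i) = ∏ i ∈ s, expNeg (x i) := by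
  classical
  induction s using Finset.induction_on with
  | empty => simp
  | insert a s ha ih => rw [Finset.sum_insert ha, Finset.prod_insert ha, expNeg_add, ih]

lemma expNeg_mul_natCast (x : ℝ≥0∞) (n : ℕ) : expNeg (x * n) = expNeg x ^ n := by
  have := expNeg_sum (Finset.range n) fun _ => x
  simpa [mul_comm] using this

lemma injective_expNeg : Function.Injective expNeg := by
  intro x y h
  by_cases hx : x = ∞ <;> by_cases hy : y = ∞
  · rw [hx, hy]
  · rw [hx, expNeg_top, expNeg_of_ne_top hy] at h
    exact absurd h (Real.exp_pos _).ne
  · rw [hy, expNeg_top, expNeg_of_ne_top hx] at h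
    exact absurd h (Real.exp_pos _).ne'
  · rw [expNeg_of_ne_top hx, expNeg_of_ne_top hy, Real.exp_eq_exp, neg_inj] at h
    exact (ENNReal.toReal_eq_toReal_iff' hx hy).1 h

lemma antitone_expNeg : Antitone expNeg := fun x y h => by
  obtain ⟨z, rfl⟩ := exists_add_of_le h
  rw [expNeg_add]
  exact mul_le_of_le_one_right (expNeg_nonneg x) (expNeg_le_one z)

/-- Supplies the test function `φ` in the thinning theorem. The value `∞` is needed at `u = 0`,
which occurs where `ρ = 1` and `ψ = ∞`. -/
lemma exists_expNeg_eq : ∃ l : ℝ → ℝ≥0∞, Measurable l ∧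
    ∀ u, 0 ≤ u → u ≤ 1 → expNeg (l u) = u := by
  classical
  refine ⟨fun u => if u = 0 then ∞ else ENNReal.ofReal (-Real.log u),
    Measurable.ite (measurableSet_singleton 0) measurable_const (by fun_prop), fun u h0 h1 => ?_⟩
  by_cases hu : u = 0
  · simp [hu]
  · simp only [hu, if_false]
    rw [expNeg_of_ne_top ENNReal.ofReal_ne_top,
      ENNReal.toReal_ofReal (neg_nonneg.2 (Real.log_nonpos h0 h1)), neg_neg,
      Real.exp_log (lt_of_le_of_ne h0 (Ne.symm hu))]

/-- Continuity of `expNeg` under the integral sign. -/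
lemma tendsto_integral_expNeg {α : Type*} [MeasurableSpace α] {m : Measure α} [IsFiniteMeasure m]
    {X : ℕ → α → ℝ≥0∞} {Z : α → ℝ≥0∞} (hX : ∀ n, Measurable (X n))
    (h : ∀ a, Filter.Tendsto (fun n => X n a) Filter.atTop (nhds (Z a))) :
    Filter.Tendsto (fun n => ∫ a, expNeg (X n a) ∂m) Filter.atTop
      (nhds (∫ a, expNeg (Z a) ∂m)) :=
  tendsto_integral_of_dominated_convergence (fun _ => 1)
    (fun n => (measurable_expNeg.comp (hX n)).aestronglyMeasurable) (integrable_const 1)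
    (fun _ => ae_of_all _ fun _ => norm_expNeg_le_one _)
    (ae_of_all _ fun a => (continuous_expNeg.tendsto (Z a)).comp (h a))

/-! ### Laplace transform of the Poisson law -/

instance isProbabilityMeasure_poissonLaw (r : ℝ≥0∞) : IsProbabilityMeasure (poissonLaw r) := by
  unfold poissonLaw
  split_ifs
  · infer_instance
  · exact Measure.isProbabilityMeasure_map .of_discrete

/-- The Laplace transform of the Poisson distribution. -/
lemma integral_expNeg_poissonLaw (r c : ℝ≥0∞) :
    ∫ k : ℕ∞, expNeg (c * k) ∂(poissonLaw r) = expNeg (ENNReal.ofReal (1 - expNeg c) * r) := by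
  unfold poissonLaw
  split_ifs with hr
  · subst hr
    rw [integral_dirac]
    -- At infinite rate the convention `0 * ∞ = 0` makes both sides `1` for `c = 0`; otherwise both
    -- vanish.
    by_cases hc : c = 0
    · simp [hc]
    · have : expNeg c < 1 := lt_of_le_of_ne (expNeg_le_one c) fun h =>
        hc (injective_expNeg (h.trans expNeg_zero.symm))
      rw [ENat.toENNReal_top, ENNReal.mul_top hc, ENNReal.mul_top]
      simpa using this
  · lift r to ℝ≥0 using hr
    rw [integral_map .of_discrete (Measurable.of_discrete).aestronglyMeasurable,
      integral_poissonMeasure]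
    simp only [ENat.toENNReal_coe, expNeg_mul_natCast, smul_eq_mul, ENNReal.toNNReal_coe]
    rw [expNeg_of_ne_top (x := ENNReal.ofReal _ * _)
        (ENNReal.mul_ne_top ENNReal.ofReal_ne_top ENNReal.coe_ne_top), ENNReal.toReal_mul,
      ENNReal.toReal_ofReal (by linarith [expNeg_le_one c]), ENNReal.coe_toReal]
    have h := (NormedSpace.expSeries_div_hasSum_exp ((r : ℝ) * expNeg c)).mul_left
      (Real.exp (-r))
    rw [← Real.exp_eq_exp_ℝ, ← Real.exp_add] at h
    rw [show -((1 - expNeg c) * (r : ℝ)) = -r + r * expNeg c by ring, ← h.tsum_eq]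
    refine tsum_congr fun n => ?_
    rw [mul_pow]; ring

/-! ### Uniqueness from moments and Laplace transforms -/

open scoped BoundedContinuousFunction in
/-- A finite measure on the unit cube is determined by its mixed moments. -/
lemma ext_of_integral_monomial_eq {ι : Type*} [Fintype ι]
    {m₁ m₂ : Measure (ι → Icc (0 : ℝ) 1)} [IsFiniteMeasure m₁] [IsFiniteMeasure m₂]
    (h : ∀ p : ι → ℕ, ∫ x, ∏ j, (x j : ℝ) ^ p j ∂m₁ = ∫ x, ∏ j, (x j : ℝ) ^ p j ∂m₂) :
    m₁ = m₂ := by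
  let mono : (ι → ℕ) → ((ι → Icc (0 : ℝ) 1) →ᵇ ℝ) := fun p =>
    BoundedContinuousFunction.mkOfCompact ⟨fun x => ∏ j, (x j : ℝ) ^ p j, by fun_prop⟩
  have mono_apply : ∀ p x, mono p x = ∏ j, (x j : ℝ) ^ p j := fun _ _ => rfl
  let V : Submodule ℝ ((ι → Icc (0 : ℝ) 1) →ᵇ ℝ) := Submodule.span ℝ (range mono)
  have hone : (1 : (ι → Icc (0 : ℝ) 1) →ᵇ ℝ) ∈ V :=
    Submodule.subset_span ⟨0, by ext x; simp [mono_apply]⟩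
  have hmul : ∀ a b, a ∈ V → b ∈ V → a * b ∈ V := by
    intro a b ha hb
    have hab := Submodule.mul_mem_mul ha hb
    rw [Submodule.span_mul_span] at hab
    refine Submodule.span_mono ?_ hab
    rintro _ ⟨_, ⟨p, rfl⟩, _, ⟨q, rfl⟩, rfl⟩
    exact ⟨p + q, by ext x; simp [mono_apply, pow_add, Finset.prod_mul_distrib]⟩
  -- Polynomials form an algebra separating points, and such an algebra determines a finite measure.
  let A : StarSubalgebra ℝ ((ι → Icc (0 : ℝ) 1) →ᵇ ℝ) :=
    { V.toSubalgebra hone hmul with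
      star_mem' := fun {a} ha => by
        have : star a = a := by ext x; simp
        rw [this]; exact ha }
  refine ext_of_forall_mem_subalgebra_integral_eq_of_polish (𝕜 := ℝ) (A := A) ?_ ?_
  · intro x y hxy
    obtain ⟨j, hj⟩ := Function.ne_iff.1 hxy
    classical
    refine ⟨_, ⟨_, ⟨mono (Pi.single j 1), Submodule.subset_span ⟨_, rfl⟩, rfl⟩, rfl⟩, ?_⟩
    have key : ∀ z, mono (Pi.single j 1) z = z j := fun z => by
      rw [mono_apply, Finset.prod_eq_single j]
      · simp
      · intro i _ hi; simp [Pi.single_eq_of_ne hi]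
      · simp
    change mono (Pi.single j 1) x ≠ mono (Pi.single j 1) y
    rw [key, key]
    exact fun h => hj (Subtype.ext h)
  · intro a ha
    change a ∈ V at ha
    induction ha using Submodule.span_induction with
    | mem a ha => obtain ⟨p, rfl⟩ := ha; exact h p
    | zero => simp
    | add a b _ _ iha ihb =>
      simp only [BoundedContinuousFunction.coe_add, Pi.add_apply]
      rw [integral_add (a.integrable _) (b.integrable _),
        integral_add (a.integrable _) (b.integrable _), iha, ihb]
    | smul r a _ iha =>
      simp only [BoundedContinuousFunction.coe_smul, integral_smul]
      rw [iha]

/-- A finite measure on vectors of counts is determined by its Laplace transform. -/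
lemma ext_of_integral_expNeg_eq {ι : Type*} [Fintype ι] {m₁ m₂ : Measure (ι → ℕ∞)}
    [IsFiniteMeasure m₁] [IsFiniteMeasure m₂]
    (h : ∀ c : ι → ℝ≥0∞, ∫ k, ∏ j, expNeg (c j * k j) ∂m₁ = ∫ k, ∏ j, expNeg (c j * k j) ∂m₂) :
    m₁ = m₂ := by
  -- The map `k ↦ e^{-k}` embeds counts, `∞` included, in the unit cube, where mixed moments are
  -- Laplace transforms at integer arguments.
  let z : (ι → ℕ∞) → (ι → Icc (0 : ℝ) 1) := fun k j =>
    ⟨expNeg (k j), expNeg_nonneg _, expNeg_le_one _⟩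
  have hz : Measurable z := by fun_prop
  have hinj : Function.Injective z := by
    intro k l hkl
    funext j
    have := congrArg (fun x => (x j : ℝ)) hkl
    exact ENat.toENNReal_inj.1 (injective_expNeg this)
  have hmap : m₁.map z = m₂.map z := by
    refine ext_of_integral_monomial_eq fun p => ?_
    have hmeas : Continuous fun x : ι → Icc (0 : ℝ) 1 => ∏ j, (x j : ℝ) ^ p j := by fun_prop
    rw [integral_map hz.aemeasurable hmeas.aestronglyMeasurable,
      integral_map hz.aemeasurable hmeas.aestronglyMeasurable]
    have := h fun j => p j
    simpa only [z, mul_comm, ← expNeg_mul_natCast] using this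
  refine Measure.ext_of_singleton fun k => ?_
  have hpre : z ⁻¹' {z k} = {k} := by
    ext l; simp [hinj.eq_iff]
  rw [← hpre, ← Measure.map_apply hz (measurableSet_singleton _), hmap,
    Measure.map_apply hz (measurableSet_singleton _)]

/-! ### Laplace functionals of point processes -/

/-- The sum of `φ` over those points `Y i` whose event `D i` occurs. -/
noncomputable def pointSum {Ω E : Type*} (D : ℕ → Set Ω) (Y : ℕ → Ω → E) (φ : E → ℝ≥0∞) (ω : Ω) :
    ℝ≥0∞ :=
  ∑' i, (D i).indicator (fun ω => φ (Y i ω)) ω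

/-- The points `Y i` whose events `D i` occur list the set `R` without repetition. -/
def ListsPoints {Ω E : Type*} (D : ℕ → Set Ω) (Y : ℕ → Ω → E) (R : Ω → Set E) (ω : Ω) : Prop :=
  R ω = {x | ∃ i, ω ∈ D i ∧ Y i ω = x} ∧ InjOn (fun i => Y i ω) {i | ω ∈ D i}

section PointSum

variable {Ω E : Type*} {D : ℕ → Set Ω} {Y : ℕ → Ω → E} {R : Ω → Set E}

lemma ListsPoints.toENNReal_pointCount {ω : Ω} (h : ListsPoints D Y R ω) (B : Set E) :
    (pointCount R B ω : ℝ≥0∞) = pointSum D Y (B.indicator 1) ω := by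
  have himg : R ω ∩ B = (fun i => Y i ω) '' {i | ω ∈ D i ∧ Y i ω ∈ B} := by
    rw [h.1]; ext x
    constructor
    · rintro ⟨⟨i, hi, rfl⟩, hx⟩; exact ⟨i, ⟨hi, hx⟩, rfl⟩
    · rintro ⟨i, ⟨hi, hx⟩, rfl⟩; exact ⟨⟨i, hi, rfl⟩, hx⟩
  rw [pointCount, himg, InjOn.encard_image (h.2.mono fun i hi => hi.1), ← ENNReal.tsum_set_one,
    tsum_subtype _ (fun _ => (1 : ℝ≥0∞)), pointSum]
  refine tsum_congr fun i => ?_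
  by_cases h1 : ω ∈ D i <;> by_cases h2 : Y i ω ∈ B <;> simp [h1, h2]

lemma pointSum_sum_mul {ι : Type*} (s : Finset ι) (c : ι → ℝ≥0∞) (φ : ι → E → ℝ≥0∞) (ω : Ω) :
    pointSum D Y (fun x => ∑ j ∈ s, c j * φ j x) ω = ∑ j ∈ s, c j * pointSum D Y (φ j) ω := by
  simp only [pointSum, ← ENNReal.tsum_mul_left]
  rw [← Summable.tsum_finsetSum fun _ _ => ENNReal.summable]
  refine tsum_congr fun i => ?_
  by_cases h : ω ∈ D i <;> simp [h]

/-- Sums over the points against a finite combination of indicators are combinations of counts. -/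
lemma ListsPoints.pointSum_eq {ω : Ω} (h : ListsPoints D Y R ω) {ι : Type*} (s : Finset ι) (c : ι → ℝ≥0∞)
    (A : ι → Set E) :
    pointSum D Y (fun x => ∑ j ∈ s, c j * (A j).indicator 1 x) ω
      = ∑ j ∈ s, c j * (pointCount R (A j) ω : ℝ≥0∞) := by
  rw [pointSum_sum_mul]
  simp only [h.toENNReal_pointCount]

lemma tendsto_pointSum {φ : ℕ → E → ℝ≥0∞} {ψ : E → ℝ≥0∞} (hmono : Monotone φ)
    (hlim : ∀ x, Filter.Tendsto (fun n => φ n x) Filter.atTop (nhds (ψ x))) (ω : Ω) :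
    Filter.Tendsto (fun n => pointSum D Y (φ n) ω) Filter.atTop (nhds (pointSum D Y ψ ω)) := by
  simp only [pointSum, ← lintegral_count]
  refine lintegral_tendsto_of_tendsto_of_monotone (fun n => Measurable.of_discrete.aemeasurable)
    (ae_of_all _ fun i n m hnm => ?_) (ae_of_all _ fun i => ?_)
  · by_cases h : ω ∈ D i
    · simpa [h] using hmono hnm (Y i ω)
    · simp [h]
  · by_cases h : ω ∈ D i
    · simpa [h] using hlim (Y i ω)
    · simp [h]

variable [MeasurableSpace Ω] [MeasurableSpace E]

lemma measurable_pointSum (hD : ∀ i, MeasurableSet (D i)) (hY : ∀ i, Measurable (Y i))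
    {φ : E → ℝ≥0∞} (hφ : Measurable φ) : Measurable (pointSum D Y φ) :=
  Measurable.tsum fun i => (hφ.comp (hY i)).indicator (hD i)

variable {Pr : Measure Ω} {ν : Measure E}

/-- The Laplace functional of a Poisson process at a finite combination of indicators of disjoint
sets. -/
lemma IsPoissonProcess.integral_prod_expNeg (hR : IsPoissonProcess Pr R ν) {ι : Type*} [Fintype ι]
    (c : ι → ℝ≥0∞) (A : ι → Set E) (hA : ∀ j, MeasurableSet (A j))
    (hdisj : Pairwise fun i j => Disjoint (A i) (A j)) :
    ∫ ω, ∏ j, expNeg (c j * (pointCount R (A j) ω : ℝ≥0∞)) ∂Pr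
      = expNeg (∑ j, ENNReal.ofReal (1 - expNeg (c j)) * ν (A j)) := by
  let e := Fintype.equivFin ι
  have hind := hR.indep_count _ (fun k => A (e.symm k)) (fun k => hA _)
    fun i j hij => hdisj (e.symm.injective.ne hij)
  have h := hind.integral_fun_prod_comp (𝕜 := ℝ)
    (f := fun k (x : ℕ∞) => expNeg (c (e.symm k) * (x : ℝ≥0∞)))
    (fun k => (hR.law_count _ (hA _)).aemeasurable)
    (fun k => Measurable.of_discrete.aestronglyMeasurable)
  have hone : ∀ j, ∫ ω, expNeg (c j * (pointCount R (A j) ω : ℝ≥0∞)) ∂Pr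
      = expNeg (ENNReal.ofReal (1 - expNeg (c j)) * ν (A j)) := fun j => by
    rw [← integral_expNeg_poissonLaw, ← (hR.law_count _ (hA j)).map_eq,
      integral_map (hR.law_count _ (hA j)).aemeasurable
        Measurable.of_discrete.aestronglyMeasurable]
  calc _ = ∫ ω, ∏ k, expNeg (c (e.symm k) * (pointCount R (A (e.symm k)) ω : ℝ≥0∞)) ∂Pr := by
        refine integral_congr_ae (ae_of_all _ fun ω => ?_)
        exact (Equiv.prod_comp e.symm
          fun j => expNeg (c j * (pointCount R (A j) ω : ℝ≥0∞))).symm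
    _ = ∏ k, expNeg (ENNReal.ofReal (1 - expNeg (c (e.symm k))) * ν (A (e.symm k))) := by
        rw [h]; exact Finset.prod_congr rfl fun k _ => hone _
    _ = _ := by
        rw [expNeg_sum]
        exact Equiv.prod_comp e.symm
          fun j => expNeg (ENNReal.ofReal (1 - expNeg (c j)) * ν (A j))

/-- The Laplace functional of a Poisson process. -/
theorem IsPoissonProcess.integral_expNeg_pointSum [IsProbabilityMeasure Pr]
    (hR : IsPoissonProcess Pr R ν) (hD : ∀ i, MeasurableSet (D i)) (hY : ∀ i, Measurable (Y i))
    (hlist : ∀ᵐ ω ∂Pr, ListsPoints D Y R ω) {φ : E → ℝ≥0∞} (hφ : Measurable φ) :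
    ∫ ω, expNeg (pointSum D Y φ ω) ∂Pr
      = expNeg (∫⁻ x, ENNReal.ofReal (1 - expNeg (φ x)) ∂ν) := by
  have hsimple : ∀ s : SimpleFunc E ℝ≥0∞, ∫ ω, expNeg (pointSum D Y s ω) ∂Pr
      = expNeg (∫⁻ x, ENNReal.ofReal (1 - expNeg (s x)) ∂ν) := by
    intro s
    have hs : (s : E → ℝ≥0∞) =
        fun x => ∑ c : s.range, (c : ℝ≥0∞) * (s ⁻¹' {(c : ℝ≥0∞)}).indicator 1 x := by
      funext x
      rw [Finset.sum_eq_single (⟨s x, s.mem_range_self x⟩ : s.range)]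
      · simp
      · rintro ⟨c, hc⟩ _ hne
        have : s x ≠ c := fun h => hne (Subtype.ext h.symm)
        simp [this]
      · simp
    have hlin : ∫⁻ x, ENNReal.ofReal (1 - expNeg (s x)) ∂ν
        = ∑ c : s.range, ENNReal.ofReal (1 - expNeg c) * ν (s ⁻¹' {(c : ℝ≥0∞)}) := by
      rw [← SimpleFunc.map_lintegral (fun c => ENNReal.ofReal (1 - expNeg c)) s |>.trans
        (Finset.sum_coe_sort s.range
          fun c => ENNReal.ofReal (1 - expNeg c) * ν (s ⁻¹' {c})).symm,
        ← SimpleFunc.lintegral_eq_lintegral]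
      rfl
    rw [hlin, ← hR.integral_prod_expNeg (fun c : s.range => (c : ℝ≥0∞))
      (fun c => s ⁻¹' {(c : ℝ≥0∞)}) (fun c => s.measurableSet_fiber _)]
    · refine integral_congr_ae (hlist.mono fun ω hω => ?_)
      simp only
      rw [← expNeg_sum, ← hω.pointSum_eq, ← hs]
    · intro a b hab
      exact Disjoint.preimage _ (disjoint_singleton.2 fun h => hab (Subtype.ext h))
  -- Simple functions increase to `φ`; the left side passes to the limit by dominated convergence,
  -- the exponent on the right by monotone convergence.
  have hlhs := tendsto_integral_expNeg (m := Pr)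
    (fun n => measurable_pointSum hD hY (SimpleFunc.eapprox φ n).measurable)
    (tendsto_pointSum (fun n m hnm => SimpleFunc.monotone_eapprox φ hnm)
      (SimpleFunc.tendsto_eapprox hφ))
  simp only [hsimple] at hlhs
  refine tendsto_nhds_unique hlhs ((continuous_expNeg.tendsto _).comp ?_)
  refine lintegral_tendsto_of_tendsto_of_monotone (fun n => ?_) (ae_of_all _ fun x n m hnm => ?_)
    (ae_of_all _ fun x => ?_)
  · have := (SimpleFunc.eapprox φ n).measurable
    fun_prop
  · exact ENNReal.ofReal_le_ofReal (sub_le_sub_left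
      (antitone_expNeg (SimpleFunc.monotone_eapprox φ hnm x)) 1)
  · have hc : Continuous fun y => ENNReal.ofReal (1 - expNeg y) :=
      ENNReal.continuous_ofReal.comp (continuous_const.sub continuous_expNeg)
    exact (hc.tendsto _).comp (SimpleFunc.tendsto_eapprox hφ x)

/-- A random countable set with the Laplace functional of a Poisson process is one. -/
theorem isPoissonProcess_of_integral_expNeg_pointSum [IsProbabilityMeasure Pr] [SigmaFinite ν]
    (hν : ∀ x, ν {x} = 0) (hcount : ∀ ω, (R ω).Countable)
    (hD : ∀ i, MeasurableSet (D i)) (hY : ∀ i, Measurable (Y i))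
    (hlist : ∀ᵐ ω ∂Pr, ListsPoints D Y R ω)
    (hlap : ∀ φ : E → ℝ≥0∞, Measurable φ → ∫ ω, expNeg (pointSum D Y φ ω) ∂Pr
      = expNeg (∫⁻ x, ENNReal.ofReal (1 - expNeg (φ x)) ∂ν)) :
    IsPoissonProcess Pr R ν := by
  have hmeas : ∀ B, MeasurableSet B → AEMeasurable (pointCount R B) Pr := by
    intro B hB
    have hm : Measurable (pointSum D Y (B.indicator 1)) :=
      measurable_pointSum hD hY (measurable_one.indicator hB)
    -- Measurability of the count is pulled back from its expression as a measurable sum over the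
    -- listed points.
    have hem : MeasurableEmbedding ((↑) : ℕ∞ → ℝ≥0∞) :=
      ⟨fun _ _ h => ENat.toENNReal_inj.1 h, .of_discrete,
        fun s _ => (s.to_countable.image _).measurableSet⟩
    exact hem.aemeasurable_comp_iff.1
      (hm.aemeasurable.congr (hlist.mono fun ω hω => (hω.toENNReal_pointCount B).symm))
  have hjoint : ∀ (m : ℕ) (A : Fin m → Set E), (∀ j, MeasurableSet (A j)) →
      Pairwise (fun i j => Disjoint (A i) (A j)) →
      Pr.map (fun ω j => pointCount R (A j) ω) = Measure.pi fun j => poissonLaw (ν (A j)) := by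
    intro m A hA hdisj
    have hvec : AEMeasurable (fun ω j => pointCount R (A j) ω) Pr :=
      aemeasurable_pi_lambda _ fun j => hmeas _ (hA j)
    have := Measure.isProbabilityMeasure_map hvec
    refine ext_of_integral_expNeg_eq fun c => ?_
    rw [integral_map hvec Measurable.of_discrete.aestronglyMeasurable,
      integral_fintype_prod_eq_prod (fun j (k : ℕ∞) => expNeg (c j * k))]
    simp only [integral_expNeg_poissonLaw]
    let ψ : E → ℝ≥0∞ := fun x => ∑ j, c j * (A j).indicator 1 x
    have hψ : Measurable ψ := Finset.measurable_sum _ fun j _ =>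
      measurable_const.mul (measurable_one.indicator (hA j))
    -- By disjointness at most one term of `ψ` is nonzero, so `1 - e^{-ψ}` splits as a sum over the
    -- sets.
    have hψ_apply : ∀ x, ENNReal.ofReal (1 - expNeg (ψ x))
        = ∑ j, (A j).indicator (fun _ => ENNReal.ofReal (1 - expNeg (c j))) x := by
      intro x
      by_cases hx : ∃ j, x ∈ A j
      · obtain ⟨j, hj⟩ := hx
        have hne : ∀ i, i ≠ j → x ∉ A i := fun i hij hi =>
          (disjoint_left.1 (hdisj hij)) hi hj
        have h1 : ψ x = c j := by
          simp only [ψ]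
          rw [Finset.sum_eq_single j (fun i _ hi => by simp [hne i hi]) (by simp)]
          simp [hj]
        rw [h1, Finset.sum_eq_single j (fun i _ hi => by simp [hne i hi]) (by simp)]
        simp [hj]
      · push Not at hx
        simp [ψ, hx]
    have h := hlap ψ hψ
    simp only [hψ_apply] at h
    rw [lintegral_finsetSum _ fun j _ => measurable_const.indicator (hA j)] at h
    simp only [lintegral_indicator_const (hA _)] at h
    rw [← expNeg_sum, ← h]
    refine integral_congr_ae (hlist.mono fun ω hω => ?_)
    simp only
    rw [← expNeg_sum, ← hω.pointSum_eq]
  have hlaw : ∀ B : Set E, MeasurableSet B →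
      HasLaw (pointCount R B) (poissonLaw (ν B)) Pr := by
    intro B hB
    refine ⟨hmeas B hB, ?_⟩
    have h := congrArg (Measure.map (Function.eval (0 : Fin 1)))
      (hjoint 1 (fun _ => B) (fun _ => hB) (Subsingleton.pairwise))
    rw [(measurePreserving_eval _ _).map_eq, AEMeasurable.map_map_of_aemeasurable
      (measurable_pi_apply _).aemeasurable
      (aemeasurable_pi_lambda _ fun _ => hmeas B hB)] at h
    exact h
  refine ⟨inferInstance, hν, hcount, hlaw, fun m A hA hdisj => ?_⟩
  rw [iIndepFun_iff_map_fun_eq_pi_map fun j => hmeas _ (hA j), hjoint m A hA hdisj]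
  simp only [(hlaw _ (hA _)).map_eq]

end PointSum

/-! ### Thinning -/

/-- Events that are conditionally independent given `m` may be replaced, in a product of affine
functions of them with `m`-measurable coefficients, by their conditional probabilities. -/
lemma integral_prod_one_add_indicator {Ω : Type*} {m mΩ : MeasurableSpace Ω} (hm : m ≤ mΩ)
    {Pr : Measure Ω} [IsProbabilityMeasure Pr] {A : ℕ → Set Ω} (hA : ∀ i, MeasurableSet (A i))
    {q u : ℕ → Ω → ℝ}
    (hq : ∀ I : Finset ℕ, Pr⟦⋂ i ∈ I, A i | m⟧ =ᵐ[Pr] fun ω => ∏ i ∈ I, q i ω)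
    (hu : ∀ i, StronglyMeasurable[m] (u i)) (hu1 : ∀ i ω, |u i ω| ≤ 1) (s : Finset ℕ) :
    ∫ ω, ∏ i ∈ s, (1 + u i ω * (A i).indicator 1 ω) ∂Pr
      = ∫ ω, ∏ i ∈ s, (1 + u i ω * q i ω) ∂Pr := by
  -- Expanding over subsets `I` leaves only intersections `⋂ i ∈ I, A i`, whose conditional
  -- probabilities are given.
  simp only [Finset.prod_one_add, Finset.prod_mul_distrib]
  have hind : ∀ (I : Finset ℕ) ω, ∏ i ∈ I, (A i).indicator (1 : Ω → ℝ) ω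
      = (⋂ i ∈ I, A i).indicator (fun _ => (1 : ℝ)) ω := by
    intro I ω
    by_cases h : ∀ i ∈ I, ω ∈ A i
    · rw [indicator_of_mem (by simpa using h)]
      exact Finset.prod_eq_one fun i hi => by simp [h i hi]
    · rw [indicator_of_notMem (by simpa using h)]
      push Not at h
      obtain ⟨i, hi, hiA⟩ := h
      exact Finset.prod_eq_zero hi (by simp [hiA])
  simp only [hind]
  have hprod : ∀ I : Finset ℕ, StronglyMeasurable[m] fun ω => ∏ i ∈ I, u i ω := fun I =>
    Finset.stronglyMeasurable_fun_prod I fun i _ => hu i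
  have hbound : ∀ (I : Finset ℕ) ω, ‖∏ i ∈ I, u i ω‖ ≤ 1 := fun I ω => by
    rw [norm_prod]
    exact Finset.prod_le_one (fun _ _ => norm_nonneg _) fun i _ => hu1 i ω
  have hint : ∀ I : Finset ℕ, Integrable ((⋂ i ∈ I, A i).indicator fun _ => (1 : ℝ)) Pr :=
    fun I => (integrable_const 1).indicator (I.measurableSet_biInter fun i _ => hA i)
  have hint_left : ∀ I : Finset ℕ, Integrable
      (fun ω => (∏ i ∈ I, u i ω) * (⋂ i ∈ I, A i).indicator (fun _ => (1 : ℝ)) ω) Pr := fun I =>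
    (hint I).bdd_mul ((hprod I).mono hm).aestronglyMeasurable (ae_of_all _ (hbound I))
  have hcond : ∀ I : Finset ℕ,
      Pr[fun ω => (∏ i ∈ I, u i ω) * (⋂ i ∈ I, A i).indicator (fun _ => (1 : ℝ)) ω | m]
        =ᵐ[Pr] fun ω => (∏ i ∈ I, u i ω) * ∏ i ∈ I, q i ω := fun I =>
    (condExp_stronglyMeasurable_mul_of_bound hm (hprod I) (hint I) 1
      (ae_of_all _ (hbound I))).trans ((hq I).mono fun ω hω => by simp only [Pi.mul_apply, hω])
  rw [integral_finsetSum _ fun I _ => hint_left I,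
    integral_finsetSum _ fun I _ => integrable_condExp.congr (hcond I)]
  refine Finset.sum_congr rfl fun I _ => ?_
  rw [← integral_congr_ae (hcond I), integral_condExp hm]

/-- **Thinning theorem.** Keeping the points `x` of a Poisson process independently with
probabilities `ρ x` yields a Poisson process whose mean measure has density `ρ`. -/
theorem IsPoissonProcess.thin {Ω E : Type*} [MeasurableSpace Ω] [MeasurableSpace E]
    {Pr : Measure Ω} [IsProbabilityMeasure Pr] {R : Ω → Set E} {ν : Measure E}
    (hR : IsPoissonProcess Pr R ν) {S : E → Ω → Bool} {ρ : E → ℝ≥0} (hρ : Measurable ρ)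
    (hρ1 : ∀ x, ρ x ≤ 1) (hS : IsBernoulliMarking Pr R S ρ) :
    IsPoissonProcess Pr (thin R S) (ν.withDensity fun x => (ρ x : ℝ≥0∞)) := by
  obtain ⟨κ, Y, hκ, hY, hlist, hD', hcond⟩ := hS
  let D : ℕ → Set Ω := fun i => {ω | (i : ℕ∞) < κ ω}
  let D' : ℕ → Set Ω := fun i => {ω | (i : ℕ∞) < κ ω ∧ S (Y i ω) ω = true}
  have hD : ∀ i, MeasurableSet (D i) := fun i => hκ (MeasurableSet.of_discrete (s := Ioi (i : ℕ∞)))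
  have hD'D : ∀ i ω, ω ∈ D' i → ω ∈ D i := fun i ω h => h.1
  have hlistR : ∀ᵐ ω ∂Pr, ListsPoints D Y R ω := hlist
  have hlistT : ∀ᵐ ω ∂Pr, ListsPoints D' Y (_root_.thin R S) ω := by
    filter_upwards [hlist] with ω ⟨h1, h2⟩
    refine ⟨?_, h2.mono fun i hi => hi.1⟩
    ext x
    simp only [_root_.thin, h1, mem_ofPred_eq, D']
    constructor
    · rintro ⟨⟨i, hi, rfl⟩, hx⟩; exact ⟨i, ⟨hi, hx⟩, rfl⟩
    · rintro ⟨i, ⟨hi, hx⟩, rfl⟩; exact ⟨⟨i, hi, rfl⟩, hx⟩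
  have := hR.sigmaFinite
  refine isPoissonProcess_of_integral_expNeg_pointSum
    (fun x => withDensity_absolutelyContinuous _ _ (hR.nonatomic x))
    (fun ω => (hR.countable ω).mono fun x hx => hx.1) hD' hY hlistT fun ψ hψ => ?_
  obtain ⟨l, hl, hexp⟩ := exists_expNeg_eq
  -- the Laplace functional at `ψ` of the thinned set is the one at `φ` of the original set
  let φ : E → ℝ≥0∞ := fun x => l (1 - ρ x * (1 - expNeg (ψ x)))
  have hφ : Measurable φ := hl.comp (by fun_prop)
  have hφ_exp : ∀ x, expNeg (φ x) = 1 - ρ x * (1 - expNeg (ψ x)) := by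
    intro x
    have h1 : (ρ x : ℝ) ≤ 1 := hρ1 x
    have h0 : 0 ≤ 1 - expNeg (ψ x) := sub_nonneg.2 (expNeg_le_one _)
    have h2 : (ρ x : ℝ) * (1 - expNeg (ψ x)) ≤ 1 :=
      mul_le_one₀ h1 h0 (by linarith [expNeg_nonneg (ψ x)])
    exact hexp _ (by linarith) (by linarith [mul_nonneg (ρ x).coe_nonneg h0])
  have hrhs : ∫⁻ x, ENNReal.ofReal (1 - expNeg (ψ x)) ∂ν.withDensity (fun x => (ρ x : ℝ≥0∞))
      = ∫⁻ x, ENNReal.ofReal (1 - expNeg (φ x)) ∂ν := by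
    rw [lintegral_withDensity_eq_lintegral_mul _ (by fun_prop) (by fun_prop)]
    refine lintegral_congr fun x => ?_
    rw [hφ_exp, sub_sub_cancel, ENNReal.ofReal_mul (ρ x).coe_nonneg, ENNReal.ofReal_coe_nnreal]
    rfl
  rw [hrhs, ← hR.integral_expNeg_pointSum hD hY hlistR hφ]
  let Z : Ω → ℕ∞ × (ℕ → E) := fun ω => (κ ω, fun i => Y i ω)
  have hZ : Measurable Z := hκ.prodMk (measurable_pi_lambda _ hY)
  -- Truncating the list at `n` gives finite products of `1 - (1 - e^{-ψ(Y i)}) 1_{D' i}`;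
  -- conditioning on the list replaces `1_{D' i}` by `ρ(Y i) 1_{D i}`.
  have hfinite : ∀ n : ℕ,
      ∫ ω, expNeg (∑ i ∈ Finset.range n, (D' i).indicator (fun ω => ψ (Y i ω)) ω) ∂Pr
        = ∫ ω, expNeg (∑ i ∈ Finset.range n, (D i).indicator (fun ω => φ (Y i ω)) ω) ∂Pr := by
    intro n
    have h := integral_prod_one_add_indicator hZ.comap_le hD' (hcond ·)
      (u := fun i ω => -(1 - expNeg (ψ (Y i ω))))
      (fun i => by
        have hf : Measurable fun z : ℕ∞ × (ℕ → E) => -(1 - expNeg (ψ (z.2 i))) := by fun_prop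
        exact (hf.comp (comap_measurable Z)).stronglyMeasurable)
      (fun i ω => by
        rw [abs_neg, abs_of_nonneg (sub_nonneg.2 (expNeg_le_one _))]
        linarith [expNeg_nonneg (ψ (Y i ω))])
      (Finset.range n)
    simp only [expNeg_sum]
    convert h using 3 with ω ω
    · refine Finset.prod_congr rfl fun i _ => ?_
      by_cases hi : ω ∈ D' i
      · simp only [D'] at hi; simp [D', hi]
      · simp only [D'] at hi; simp [D', hi]
    · refine Finset.prod_congr rfl fun i _ => ?_
      by_cases hi : (i : ℕ∞) < κ ω
      · simp [D, hi, hφ_exp]; ring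
      · simp [D, hi]
  have hlim : ∀ (B : ℕ → Set Ω) (χ : E → ℝ≥0∞), (∀ i, MeasurableSet (B i)) → Measurable χ →
      Filter.Tendsto (fun n => ∫ ω, expNeg
        (∑ i ∈ Finset.range n, (B i).indicator (fun ω => χ (Y i ω)) ω) ∂Pr) Filter.atTop
        (nhds (∫ ω, expNeg (pointSum B Y χ ω) ∂Pr)) := fun B χ hB hχ =>
    tendsto_integral_expNeg
      (fun n => Finset.measurable_sum _ fun i _ => (hχ.comp (hY i)).indicator (hB i))
      (fun ω => ENNReal.tendsto_nat_tsum _)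
  exact tendsto_nhds_unique (hlim D' ψ hD' hψ) (by simpa only [hfinite] using hlim D φ hD hφ)

/-! ### Accept-reject for exponential races -/

theorem mainTheorem2 {Ω : Type*} [MeasurableSpace Ω] (Pr : Measure Ω) [IsProbabilityMeasure Pr]
    (n : ℕ) (μ P Q : Measure (EuclideanSpace ℝ (Fin n)))
    (hPfin : IsFiniteMeasure P) (hQfin : IsFiniteMeasure Q) (hP0 : P ≠ 0) (hQ0 : Q ≠ 0)
    (f g : EuclideanSpace ℝ (Fin n) → ℝ≥0) (hf : Measurable f) (hg : Measurable g)
    (hP : P = μ.withDensity (fun x => (f x : ℝ≥0∞)))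
    (hQ : Q = μ.withDensity (fun x => (g x : ℝ≥0∞)))
    (hsupp : Function.support f = Function.support g)
    (M : ℝ≥0) (hM : ∀ x ∈ Function.support g, f x / g x ≤ M)
    (R : Ω → Set (ℝ × EuclideanSpace ℝ (Fin n))) (hR : IsExponentialRace Pr R (M • Q))
    (accept : ℝ × EuclideanSpace ℝ (Fin n) → Ω → Bool)
    (haccept : IsBernoulliMarking Pr R accept (fun p => f p.2 / (g p.2 * M))) :
    IsExponentialRace Pr (thin R accept) P := by
  have hM0 : M ≠ 0 := fun h => hR.nonzero (by simp [h])
  have hfg : ∀ x, f x = M * g x * (f x / (g x * M)) := by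
    intro x
    by_cases hx : g x = 0
    · have : f x = 0 := by
        by_contra h
        exact (hsupp ▸ Function.mem_support.2 h : x ∈ Function.support g) hx
      simp [this]
    · field_simp
  have hρ1 : ∀ p : ℝ × EuclideanSpace ℝ (Fin n), f p.2 / (g p.2 * M) ≤ 1 := by
    intro p
    -- Off the support of `g` the quotient is `0` by convention, so the bound holds everywhere.
    by_cases hx : g p.2 = 0
    · simp [hx]
    · rw [← div_div]
      exact div_le_one_of_le₀ (hM _ hx) zero_le
  have hρ : Measurable fun x => f x / (g x * M) := by fun_prop
  have hdens : P = (M • Q).withDensity fun x => ((f x / (g x * M) : ℝ≥0) : ℝ≥0∞) := by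
    have hMQ : M • Q = μ.withDensity fun x => ((M * g x : ℝ≥0) : ℝ≥0∞) := by
      rw [hQ]
      exact (withDensity_smul (M : ℝ≥0∞) (f := fun x => (g x : ℝ≥0∞)) (by fun_prop)).symm.trans
        (by congr 1)
    rw [hMQ, ← withDensity_mul _ (by fun_prop) (by fun_prop), hP]
    congr 1
    funext x
    rw [Pi.mul_apply, ← ENNReal.coe_mul, ← hfg]
  have hrace : raceMeasure P = (raceMeasure (M • Q)).withDensity
      fun p => ((f p.2 / (g p.2 * M) : ℝ≥0) : ℝ≥0∞) := by
    -- The acceptance probability does not depend on time, so it acts as a density on the second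
    -- factor alone.
    have h := prod_withDensity_right (μ := volume.restrict (Ioi (0 : ℝ))) (ν := M • Q)
      hρ.coe_nnreal_ennreal
    rwa [← hdens] at h
  refine ⟨hPfin, hP0, fun ω x hx => hR.subset ω hx.1, ?_,
    hR.ordered.mono fun ω h => h.mono fun x hx => hx.1⟩
  rw [hrace]
  exact hR.poisson.thin (hρ.comp measurable_snd) hρ1 haccept
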